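/- For groups $A$, $B$ and an integer $k\ge 1$, the $k$-nilpotent product $A\amalg^{\mathfrak N_k}B$ is the group $F/F_{k+1}$, where $F=A*B$ is the free product and $F_1=F$, $F_{n+1}=[F_n,F]$ is its lower central series. Let $p$ be a prime and let $c\ge 1$ be an integer. Let $C_p=\langle a\rangle$ be a cyclic group of order $p$ and let $\mathbf Z=\langle z\rangle$ be an infinite cyclic group, written multiplicatively. Let $\mathcal G=C_p\amalg^{\mathfrak N_{c+1}}\mathbf Z$ be their $(c+1)$-nilpotent product, and write $z$ also for the image of $z$ in $\mathcal G$. Then $$Z(\mathcal G)\cap\langle z\rangle=\Bigl\langle z^{\,p^{\,1+\lfloor (c-1)/(p-1)\rfloor}}\Bigr\rangle .$$ -/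

import Mathlib

/-- The `c`-nilpotent product of `A` and `B`: the quotient `F / F_{c+1}` of the free product
`F = A ∗ B` by the `(c+1)`-st term of its lower central series, numbered so that `F_1 = F` and
`F_{n+1} = [F_n, F]`. Mathlib numbers the series from `0`, so `F_{c+1}` is its term `c`. -/
abbrev NilpotentProduct (c : ℕ) (A B : Type*) [Group A] [Group B] : Type _ :=
  Monoid.Coprod A B ⧸ (⊤ : Subgroup (Monoid.Coprod A B)).lowerCentralSeries c

namespace NilpotentProduct

/-- The canonical homomorphism from the first factor to the nilpotent product. -/
def inl (c : ℕ) (A B : Type*) [Group A] [Group B] : A →* NilpotentProduct c A B :=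
  (QuotientGroup.mk' ((⊤ : Subgroup (Monoid.Coprod A B)).lowerCentralSeries c)).comp
    Monoid.Coprod.inl

/-- The canonical homomorphism from the second factor to the nilpotent product. -/
def inr (c : ℕ) (A B : Type*) [Group A] [Group B] : B →* NilpotentProduct c A B :=
  (QuotientGroup.mk' ((⊤ : Subgroup (Monoid.Coprod A B)).lowerCentralSeries c)).comp
    Monoid.Coprod.inr

end NilpotentProduct

/-!
Write `Γ n` for the `n`-th term of the lower central series, numbered from `Γ 0 = ⊤`, let
`e = 1 + (c - 1) / (p - 1)` (the least `e` with `e * (p - 1) ≥ c`), and denote by `a` and `z` also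
the images of the generators in the nilpotent product. As these images generate, `z ^ m` is central
iff it commutes with `a`.

Upper bound: `z ^ p ^ e` is central. In a group of class less than `p` whose derived subgroup has
exponent `p`, the `p`-th power map is a homomorphism (`mul_pow_prime_of_lowerCentralSeries_eq_bot`).
This is shown by induction on the class without collecting commutators, in the relatively free group
on `x`, `y`. By the inductive hypothesis, `p`-th powers are central and depend only on classes
modulo the derived subgroup, and `(x * y) ^ p = x ^ p * y ^ p * d` with `d` in the last nontrivial
term `Γ n`, where `1 ≤ n < p - 1`. The endomorphism taking `x`, `y` to their `m`-th powers takes `d`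
to `d ^ m ^ (n + 1)`, because commutators are multilinear, and to `d ^ m`, because both sides of the
formula are raised to the `m`-th power. For `m` a primitive root modulo `p` this forces `d = 1`.

Applied to the subgroups generated by one element and a term `Γ i`, the power formula shows for a
group generated by `a`, `z` with `a ^ p = 1` that `p`-th powers of elements of `Γ i`, `i ≥ 1`, lie in
`Γ (i + (p - 1))` (`pow_mem_lowerCentralSeries`), and then that `⁅a, z ^ p ^ k⁆` lies in
`Γ (k * (p - 1) + 1)` (`commutatorElement_pow_prime_pow_mem`). For `k = e` the latter is trivial.

Lower bound: let `ζ` be a primitive `p`-th root of unity and `π = ζ - 1` in `R = ℤ[ζ]`. In the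
semidirect product of `R ⧸ π ^ (c + 1)` with `⟨a⟩`, where `a` acts as multiplication by `ζ`, the class
is at most `c + 1`. Sending `z` to the translation by `1`, the commutator of `a` with `z ^ m` is the
translation by `π * m`, so if `z ^ m` is central then `π ^ c ∣ m`. As `π ^ (p - 1)` is associated to
`p`, this means `p ^ e ∣ m`.
-/

/-- `Γ[G] n` is the term of index `n` of the lower central series of `G`, numbered from
`Γ[G] 0 = ⊤`; the group `G` has class at most `n` iff `Γ[G] n = ⊥`. -/
local notation "Γ[" G "]" => Subgroup.lowerCentralSeries (⊤ : Subgroup G)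

open Subgroup
open scoped commutatorElement

/-! ### The lower central series of quotients and subgroups -/

section LowerCentralSeries

variable {G H : Type*} [Group G] [Group H]

theorem map_mem_lowerCentralSeries (f : G →* H) {n : ℕ} {g : G} (hg : g ∈ Γ[G] n) :
    f g ∈ Γ[H] n :=
  lowerCentralSeries_mono n le_top
    ((map_lowerCentralSeries ⊤ f n).le (mem_map_of_mem f hg))

theorem exists_mem_lowerCentralSeries_of_surjective {f : G →* H} (hf : Function.Surjective f)
    {n : ℕ} {h : H} (hh : h ∈ Γ[H] n) : ∃ g ∈ Γ[G] n, f g = h := by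
  have := map_lowerCentralSeries ⊤ f n
  rw [map_top_of_surjective f hf] at this
  rwa [← this, mem_map] at hh

theorem lowerCentralSeries_quotient_eq_bot (N : Subgroup G) [N.Normal] {n : ℕ}
    (hN : Γ[G] n ≤ N) : Γ[G ⧸ N] n = ⊥ := by
  rw [eq_bot_iff]
  intro h hh
  obtain ⟨g, hg, rfl⟩ :=
    exists_mem_lowerCentralSeries_of_surjective (QuotientGroup.mk'_surjective N) hh
  exact (QuotientGroup.eq_one_iff g).mpr (hN hg)

theorem commute_of_mem_lowerCentralSeries {n : ℕ} (h : Γ[G] (n + 1) = ⊥) {u : G}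
    (hu : u ∈ Γ[G] n) (g : G) : Commute u g := by
  rw [← commutatorElement_eq_one_iff_commute, ← mem_bot, ← h]
  exact commutator_mem_commutator hu (mem_top g)

/-- If the class of `G` is at most `k + 1`, then the `k`-th term of the lower central series
centralizes the derived subgroup, by the three subgroups lemma. -/
theorem commute_lowerCentralSeries_derived {k : ℕ} (h : Γ[G] (k + 2) = ⊥) {u v : G}
    (hu : u ∈ Γ[G] k) (hv : v ∈ Γ[G] 1) : Commute u v := by
  have h1 : ⁅⁅Γ[G] k, (⊤ : Subgroup G)⁆, (⊤ : Subgroup G)⁆ = ⊥ := h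
  have h2 : ⁅⁅(⊤ : Subgroup G), (⊤ : Subgroup G)⁆, Γ[G] k⁆ = ⊥ :=
    commutator_commutator_eq_bot_of_rotate (by rwa [commutator_comm ⊤ (Γ[G] k)]) h1
  refine (Commute.symm ?_)
  rw [← commutatorElement_eq_one_iff_commute, ← mem_bot, ← h2]
  exact commutator_mem_commutator hv hu

theorem commutatorElement_pow_right_of_commute {x y : G} (h : Commute ⁅x, y⁆ y) (n : ℕ) :
    ⁅x, y ^ n⁆ = ⁅x, y⁆ ^ n := by
  have h1 : x * y * x⁻¹ = ⁅x, y⁆ * y := by simp [commutatorElement_def]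
  rw [commutatorElement_def x (y ^ n), ← conj_pow, h1, h.mul_pow, mul_inv_cancel_right]

theorem commutatorElement_pow_left_of_commute {x y : G} (h : Commute ⁅x, y⁆ x) (n : ℕ) :
    ⁅x ^ n, y⁆ = ⁅x, y⁆ ^ n := by
  rw [← inv_inj, commutatorElement_inv, ← inv_pow, commutatorElement_inv]
  refine commutatorElement_pow_right_of_commute ?_ n
  rw [← commutatorElement_inv]
  exact h.inv_left

/-- Homogeneity: if `f` is the `m`-th power of `g` modulo the derived subgroup, then on the
`k`-th term of the lower central series it is the `m ^ (k + 1)`-th power of `g` modulo the next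
term. -/
theorem inv_mul_mem_lowerCentralSeries_of_pow (f g : G →* H) (m : ℕ)
    (hfg : ∀ x, (g x ^ m)⁻¹ * f x ∈ Γ[H] 1) (k : ℕ) :
    ∀ u ∈ Γ[G] k, (g u ^ m ^ (k + 1))⁻¹ * f u ∈ Γ[H] (k + 1) := by
  induction k with
  | zero => simpa using hfg
  | succ k ih =>
    set q := QuotientGroup.mk' (Γ[H] (k + 2))
    have hbot : Γ[H ⧸ Γ[H] (k + 2)] (k + 2) = ⊥ := lowerCentralSeries_quotient_eq_bot _ le_rfl
    -- Modulo the term of index `k + 2` both sides are homomorphisms into an abelian group.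
    suffices ∀ u ∈ Γ[G] (k + 1), q (f u) = q (g u) ^ m ^ (k + 2) by
      intro u hu
      have h := this u hu
      rw [← map_pow, eq_comm] at h
      exact QuotientGroup.eq.mp h
    intro u hu
    rw [Subgroup.mem_lowerCentralSeries_succ_iff] at hu
    induction hu using closure_induction with
    | one => rw [_root_.map_one f, _root_.map_one g, _root_.map_one q, one_pow]
    | mul x y hx hy hfx hfy =>
      have hc : Commute (q (g x)) (q (g y)) := commute_of_mem_lowerCentralSeries hbot
        (map_mem_lowerCentralSeries q (map_mem_lowerCentralSeries g hx)) _
      simp only [map_mul, hfx, hfy, hc.mul_pow]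
    | inv x hx hfx => simp only [map_inv, hfx, inv_pow]
    | mem x hx =>
      obtain ⟨u, hu, y, -, rfl⟩ := hx
      obtain ⟨w, hw, hfu⟩ : ∃ w ∈ Γ[H] (k + 1), f u = g u ^ m ^ (k + 1) * w :=
        ⟨_, ih u hu, by group⟩
      obtain ⟨v, hv, hfy⟩ : ∃ v ∈ Γ[H] 1, f y = g y ^ m * v := ⟨_, hfg y, by group⟩
      have hqu := map_mem_lowerCentralSeries q (map_mem_lowerCentralSeries g hu)
      have hcw := commute_of_mem_lowerCentralSeries hbot (map_mem_lowerCentralSeries q hw)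
      have hcv := commute_lowerCentralSeries_derived hbot (pow_mem hqu (m ^ (k + 1)))
        (map_mem_lowerCentralSeries q hv)
      have hcc := commute_of_mem_lowerCentralSeries (u := ⁅q (g u), q (g y)⁆) hbot
        (commutator_mem_commutator hqu (mem_top _))
      have hcm : ⁅q (g u), q (g y) ^ m⁆ = ⁅q (g u), q (g y)⁆ ^ m :=
        commutatorElement_pow_right_of_commute (hcc _) m
      rw [map_commutatorElement, map_commutatorElement, map_commutatorElement,
        map_commutatorElement, hfu, hfy]
      simp only [map_mul, map_pow]
      rw [commutatorElement_mul_left_eq_conj_mul, (hcw _).commutator_eq,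
        commutatorElement_mul_right_eq_mul_conj, hcv.commutator_eq]
      simp only [mul_one, mul_inv_cancel, one_mul]
      rw [commutatorElement_pow_left_of_commute, hcm, ← pow_mul, ← pow_succ',
        mul_inv_cancel_right]
      rw [hcm]
      exact (hcc _).pow_left m

/-- Adjoining one element to a term of the lower central series gives a subgroup of smaller
class: its own lower central series starts with the next term. -/
theorem lowerCentralSeries_zpowers_sup_le (x : G) (i k : ℕ) :
    (zpowers x ⊔ Γ[G] i).lowerCentralSeries (k + 1) ≤ Γ[G] (i + (k + 1)) := by
  induction k with
  | zero =>
    simp only [zero_add, Subgroup.lowerCentralSeries_succ, Subgroup.lowerCentralSeries_zero]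
    rw [commutator_le]
    intro g hg h hh
    obtain ⟨_, ⟨m, rfl⟩, u, hu, rfl⟩ := mem_sup_of_normal_right.mp hg
    obtain ⟨_, ⟨n, rfl⟩, v, hv, rfl⟩ := mem_sup_of_normal_right.mp hh
    set q := QuotientGroup.mk' (Γ[G] (i + 1))
    have hbot : Γ[G ⧸ Γ[G] (i + 1)] (i + 1) = ⊥ := lowerCentralSeries_quotient_eq_bot _ le_rfl
    have hcu := commute_of_mem_lowerCentralSeries hbot (map_mem_lowerCentralSeries q hu)
    have hcv := commute_of_mem_lowerCentralSeries hbot (map_mem_lowerCentralSeries q hv)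
    rw [← QuotientGroup.eq_one_iff]
    change q ⁅_, _⁆ = 1
    rw [map_commutatorElement, commutatorElement_eq_one_iff_commute, map_mul, map_mul]
    refine Commute.mul_left (Commute.mul_right ?_ (hcv _).symm) (hcu _)
    simp only [map_zpow]
    exact (Commute.refl (q x)).zpow_zpow m n
  | succ k ih =>
    rw [Subgroup.lowerCentralSeries_succ]
    exact commutator_mono ih le_top

end LowerCentralSeries

/-! ### The power map of a group of small class -/

section PowerMap

variable {G : Type*} [Group G]

/-- If all subgroups of `G` of class at most `n` whose derived subgroup has exponent `p` satisfy
`(x * y) ^ p = x ^ p * y ^ p`, then this holds in `G` for `y` in a term `Γ[G] i` of the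
lower central series such that `Γ[G] (i + 1)` has exponent `p` and `Γ[G] (i + n) = ⊥`. -/
theorem mul_pow_of_mem_lowerCentralSeries_of_subgroups {p n i : ℕ} (hn : 1 ≤ n)
    (hpow : ∀ H : Subgroup G, Γ[H] n = ⊥ → (∀ u ∈ Γ[H] 1, u ^ p = 1) →
      ∀ x y : H, (x * y) ^ p = x ^ p * y ^ p)
    (hbot : Γ[G] (i + n) = ⊥) (hexp : ∀ u ∈ Γ[G] (i + 1), u ^ p = 1)
    (x : G) {y : G} (hy : y ∈ Γ[G] i) :
    (x * y) ^ p = x ^ p * y ^ p ∧ (y * x) ^ p = y ^ p * x ^ p := by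
  set H := zpowers x ⊔ Γ[G] i
  have hx : x ∈ H := mem_sup_left (mem_zpowers x)
  have hy : y ∈ H := mem_sup_right hy
  have key := hpow H (by
    obtain ⟨k, rfl⟩ := Nat.exists_eq_add_of_le' hn
    rw [← map_subtype_inj, Subgroup.map_bot, top_subtype_lowerCentralSeries, eq_bot_iff, ← hbot]
    exact lowerCentralSeries_zpowers_sup_le x i k) (by
    intro u hu
    have h1 : (u : G) ∈ H.lowerCentralSeries 1 := by
      rw [← top_subtype_lowerCentralSeries]
      exact mem_map_of_mem H.subtype hu
    exact Subtype.ext (hexp u (lowerCentralSeries_zpowers_sup_le x i 0 h1)))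
  exact ⟨congrArg Subtype.val (key ⟨x, hx⟩ ⟨y, hy⟩), congrArg Subtype.val (key ⟨y, hy⟩ ⟨x, hx⟩)⟩

/-- The verbal subgroup of the free group on two generators generated by the term `Γ n` of its
lower central series and the `p`-th powers of the elements of its derived subgroup. -/
def derivedPowSubgroup (p n : ℕ) : Subgroup (FreeGroup Bool) :=
  normalClosure ({u | u ∈ Γ[FreeGroup Bool] n} ∪ {v | ∃ u ∈ Γ[FreeGroup Bool] 1, u ^ p = v})

instance (p n : ℕ) : (derivedPowSubgroup p n).Normal := normalClosure_normal

/-- The free group on two generators among the groups of class at most `n` whose derived subgroup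
has exponent dividing `p`. -/
abbrev RelFree (p n : ℕ) : Type := FreeGroup Bool ⧸ derivedPowSubgroup p n

namespace RelFree

variable {p n : ℕ}

/-- The two free generators, indexed by `Bool`. -/
def gen (p n : ℕ) (b : Bool) : RelFree p n := QuotientGroup.mk (FreeGroup.of b)

theorem lowerCentralSeries_eq_bot (p n : ℕ) : Γ[RelFree p n] n = ⊥ :=
  lowerCentralSeries_quotient_eq_bot _ fun _ hu => subset_normalClosure (Or.inl hu)

theorem pow_eq_one {u : RelFree p n} (hu : u ∈ Γ[RelFree p n] 1) : u ^ p = 1 := by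
  obtain ⟨g, hg, rfl⟩ := exists_mem_lowerCentralSeries_of_surjective
    (QuotientGroup.mk'_surjective (derivedPowSubgroup p n)) hu
  exact (QuotientGroup.eq_one_iff _).mpr (subset_normalClosure (Or.inr ⟨g, hg, rfl⟩))

/-- The universal property of the relatively free group. -/
theorem exists_lift {P : Type*} [Group P] (hbot : Γ[P] n = ⊥) (hexp : ∀ u ∈ Γ[P] 1, u ^ p = 1)
    (x : Bool → P) : ∃ f : RelFree p n →* P, ∀ b, f (gen p n b) = x b := by
  refine ⟨QuotientGroup.lift _ (FreeGroup.lift x) ?_, fun b => ?_⟩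
  · refine normalClosure_le_normal ?_
    rintro v (hv | ⟨u, hu, rfl⟩)
    · have := map_mem_lowerCentralSeries (FreeGroup.lift x) hv
      rwa [hbot, mem_bot] at this
    · change FreeGroup.lift x (u ^ p) = 1
      rw [map_pow, hexp _ (map_mem_lowerCentralSeries _ hu)]
  · exact (QuotientGroup.lift_mk' _ _ _).trans FreeGroup.lift_apply_of

/-- A homomorphism that sends the generators to their `m`-th powers is the `m`-th power map
modulo the derived subgroup. -/
theorem inv_mul_mem_of_gen {f : RelFree p n →* RelFree p n} {m : ℕ}
    (hf : ∀ b, f (gen p n b) = gen p n b ^ m) (x : RelFree p n) :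
    (x ^ m)⁻¹ * f x ∈ Γ[RelFree p n] 1 := by
  let q : RelFree p n →* Abelianization (RelFree p n) := Abelianization.of
  suffices q x ^ m = q (f x) by
    rw [← map_pow] at this
    exact QuotientGroup.eq.mp this
  have h : ((powMonoidHom m).comp q).comp (QuotientGroup.mk' _) =
      (q.comp f).comp (QuotientGroup.mk' _) := by
    refine FreeGroup.ext_hom _ _ fun b => ?_
    change q (gen p n b) ^ m = q (f (gen p n b))
    rw [hf, map_pow]
  obtain ⟨w, rfl⟩ := QuotientGroup.mk'_surjective (derivedPowSubgroup p n) x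
  exact DFunLike.congr_fun h w

end RelFree

/-- A primitive root modulo `p` is a witness. -/
theorem exists_not_dvd_pow_sub {p : ℕ} (hp : p.Prime) {n : ℕ} (hn : 1 ≤ n) (hnp : n + 1 < p) :
    ∃ m : ℕ, 1 ≤ m ∧ ¬ p ∣ m ^ (n + 1) - m := by
  have := Fact.mk hp
  obtain ⟨g, hg⟩ := IsCyclic.exists_generator (α := (ZMod p)ˣ)
  have hord : orderOf g = p - 1 := by
    rw [orderOf_eq_card_of_forall_mem_zpowers hg, Nat.card_eq_fintype_card, ZMod.card_units]
  have hm : (((g : ZMod p).val : ℕ) : ZMod p) = g := ZMod.natCast_zmod_val _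
  have hm1 : 1 ≤ (g : ZMod p).val := by
    rw [Nat.one_le_iff_ne_zero, Ne, ZMod.val_eq_zero]
    exact g.ne_zero
  refine ⟨(g : ZMod p).val, hm1, fun hdvd => ?_⟩
  rw [← ZMod.natCast_eq_zero_iff, Nat.cast_sub (Nat.le_self_pow (by omega) _), Nat.cast_pow, hm,
    sub_eq_zero, pow_succ, mul_eq_right₀ g.ne_zero, ← Units.val_pow_eq_pow_val,
    Units.val_eq_one] at hdvd
  have := Nat.le_of_dvd (by omega) (orderOf_dvd_of_pow_eq_one hdvd)
  omega

/-- In a group of class less than `p` whose derived subgroup has exponent dividing `p`, the `p`-th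
power map is a homomorphism. -/
theorem mul_pow_prime_of_lowerCentralSeries_eq_bot {p : ℕ} (hp : p.Prime) {n : ℕ} (hnp : n < p) :
    ∀ {P : Type*} [Group P], Γ[P] n = ⊥ → (∀ u ∈ Γ[P] 1, u ^ p = 1) →
      ∀ x y : P, (x * y) ^ p = x ^ p * y ^ p := by
  -- It suffices to treat the generators of the relatively free group.
  suffices hfree : (RelFree.gen p n true * RelFree.gen p n false) ^ p =
      RelFree.gen p n true ^ p * RelFree.gen p n false ^ p by
    intro P _ hbot hexp x y
    obtain ⟨f, hf⟩ := RelFree.exists_lift hbot hexp fun b => bif b then x else y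
    have h := congrArg f hfree
    simpa [hf] using h
  induction n with
  | zero =>
    have h : ∀ z : RelFree p 0, z = 1 := fun z => by
      rw [← mem_bot, ← RelFree.lowerCentralSeries_eq_bot p 0]
      exact mem_top z
    rw [h ((_ * _) ^ p), h (_ ^ p * _)]
  | succ n ih =>
    have hbot := RelFree.lowerCentralSeries_eq_bot p (n + 1)
    set x := RelFree.gen p (n + 1) true
    set y := RelFree.gen p (n + 1) false
    rcases Nat.eq_zero_or_pos n with rfl | hn
    · exact (commute_of_mem_lowerCentralSeries hbot (mem_top x) y).mul_pow p
    -- The inductive hypothesis passes from the relatively free group to all groups.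
    have ih' : ∀ {P : Type} [Group P], Γ[P] n = ⊥ → (∀ u ∈ Γ[P] 1, u ^ p = 1) →
        ∀ x y : P, (x * y) ^ p = x ^ p * y ^ p := by
      intro P _ hbot hexp x y
      obtain ⟨f, hf⟩ := RelFree.exists_lift hbot hexp fun b => bif b then x else y
      have h := congrArg f (ih (by omega))
      simpa [hf] using h
    -- Factors in the derived subgroup do not affect `p`-th powers.
    have hmul : ∀ (g : RelFree p (n + 1)), ∀ u ∈ Γ[RelFree p (n + 1)] 1,
        (g * u) ^ p = g ^ p := by
      intro g u hu
      rw [(mul_pow_of_mem_lowerCentralSeries_of_subgroups hn (fun H => ih') 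
        ((congrArg Γ[RelFree p (n + 1)] (add_comm 1 n)).trans hbot)
        (fun u hu => RelFree.pow_eq_one (Subgroup.lowerCentralSeries_antitone _ (by omega) hu)) g hu).1,
        RelFree.pow_eq_one hu, mul_one]
    have hcent : ∀ g h : RelFree p (n + 1), Commute (g ^ p) h := by
      intro g h
      have h1 : h * g * h⁻¹ = g * ⁅g⁻¹, h⁆ := by simp [commutatorElement_def, mul_assoc]
      have h2 := congrArg (· ^ p) h1
      simp only [conj_pow] at h2
      rw [hmul _ _ (commutator_mem_commutator (mem_top _) (mem_top _)),
        mul_inv_eq_iff_eq_mul] at h2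
      exact h2.symm
    -- By the inductive hypothesis the defect `d` lies in the last term of the series.
    obtain ⟨d, hd, hxy⟩ : ∃ d ∈ Γ[RelFree p (n + 1)] n, (x * y) ^ p = x ^ p * y ^ p * d := by
      refine ⟨(x ^ p * y ^ p)⁻¹ * (x * y) ^ p, ?_, by group⟩
      let q := QuotientGroup.mk' (Γ[RelFree p (n + 1)] n)
      have h := ih' (lowerCentralSeries_quotient_eq_bot _ le_rfl) (fun u hu => by
        obtain ⟨g, hg, rfl⟩ := exists_mem_lowerCentralSeries_of_surjective
          (QuotientGroup.mk'_surjective _) hu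
        rw [← map_pow, RelFree.pow_eq_one hg, map_one]) (q x) (q y)
      rw [← map_mul, ← map_pow, ← map_pow, ← map_pow, ← map_mul] at h
      exact QuotientGroup.eq.mp h.symm
    suffices d = 1 by rw [hxy, this, mul_one]
    have hdp : d ^ p = 1 := RelFree.pow_eq_one (Subgroup.lowerCentralSeries_antitone _ hn hd)
    have hdc := commute_of_mem_lowerCentralSeries hbot hd
    obtain ⟨m, hm, hpm⟩ := exists_not_dvd_pow_sub hp hn hnp
    obtain ⟨f, hf⟩ := RelFree.exists_lift hbot (fun u => RelFree.pow_eq_one)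
      fun b => RelFree.gen p (n + 1) b ^ m
    have hfm := RelFree.inv_mul_mem_of_gen hf
    -- The endomorphism `f` multiplies the defect by `m ^ (n + 1)`, by homogeneity.
    have hf1 : f d = d ^ m ^ (n + 1) := by
      have := inv_mul_mem_lowerCentralSeries_of_pow f (MonoidHom.id _) m hfm n d hd
      rw [hbot, mem_bot, inv_mul_eq_one] at this
      exact this.symm
    -- It also multiplies it by `m`, since `p`-th powers only depend on the abelianization.
    have hf2 : f d = d ^ m := by
      have h1 : f ((x * y) ^ p) = ((x * y) ^ p) ^ m := by
        have h2 : f (x * y) = (x * y) ^ m * (((x * y) ^ m)⁻¹ * f (x * y)) := by group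
        rw [map_pow, h2, hmul _ _ (hfm _), ← pow_mul, ← pow_mul, mul_comm]
      rw [hxy, map_mul, map_mul, map_pow, map_pow, hf, hf, ((hdc _).symm).mul_pow,
        (hcent x _).mul_pow, ← pow_mul, ← pow_mul, mul_comm m, pow_mul, pow_mul] at h1
      exact mul_left_cancel h1
    have h3 : d ^ (m ^ (n + 1) - m) = 1 := by
      rw [pow_sub _ (Nat.le_self_pow (by omega) m), ← hf1, hf2, mul_inv_cancel]
    have h4 := Nat.dvd_gcd (orderOf_dvd_of_pow_eq_one hdp) (orderOf_dvd_of_pow_eq_one h3)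
    rwa [((Nat.Prime.coprime_iff_not_dvd hp).mpr hpm).gcd_eq_one, Nat.dvd_one, orderOf_eq_one_iff] at h4

/-- The subgroup generated by `x` and `Γ[G] i` has class at most `n` under these hypotheses, even if
the class of `G` itself is large. -/
theorem mul_pow_prime_of_mem_lowerCentralSeries {G : Type*} [Group G] {p : ℕ} (hp : p.Prime)
    {n i : ℕ} (hn : 1 ≤ n) (hnp : n < p)
    (hbot : Γ[G] (i + n) = ⊥) (hexp : ∀ u ∈ Γ[G] (i + 1), u ^ p = 1)
    (x : G) {y : G} (hy : y ∈ Γ[G] i) :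
    (x * y) ^ p = x ^ p * y ^ p ∧ (y * x) ^ p = y ^ p * x ^ p :=
  mul_pow_of_mem_lowerCentralSeries_of_subgroups hn
    (fun _ => mul_pow_prime_of_lowerCentralSeries_eq_bot hp hnp) hbot hexp x hy

end PowerMap

/-! ### Exponents of the lower central factors -/

section Exponents

variable {G : Type*} [Group G]

/-- Commutators with a fixed element `u` lie in a normal subgroup `K` as soon as those with
generators do. -/
theorem commutatorElement_mem_of_closure_eq_top {K : Subgroup G} [K.Normal] {s : Set G}
    (hs : closure s = ⊤) {u : G} (h : ∀ g ∈ s, ⁅u, g⁆ ∈ K) (g : G) : ⁅u, g⁆ ∈ K := by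
  have hiff : ∀ g, ⁅u, g⁆ ∈ K ↔
      g ∈ (centralizer {QuotientGroup.mk' K u}).comap (QuotientGroup.mk' K) := by
    intro g
    rw [mem_comap, mem_centralizer_singleton_iff, ← QuotientGroup.eq_one_iff, @eq_comm _ (_ * _),
      ← commutatorElement_eq_one_iff_mul_comm, ← map_commutatorElement]
    rfl
  rw [hiff]
  have : closure s ≤ (centralizer {QuotientGroup.mk' K u}).comap (QuotientGroup.mk' K) :=
    (closure_le _).mpr fun g hg => (hiff g).mp (h g hg)
  rw [hs] at this
  exact this (mem_top g)

/-- If `Γ (i + 2)` has exponent `p`, the `p`-th power map is a homomorphism on `Γ (i + 1)`, and the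
commutators generating `Γ (i + 1)` lie in its kernel: those with `a` because `a` has order dividing
`p`, those with `z` because `p`-th powers of elements of `Γ i` are central. For `i = 0` commutators
with `a` suffice. -/
theorem pow_eq_one_of_mem_lowerCentralSeries {p : ℕ} (hp : p.Prime) {a z : G}
    (hgen : closure {a, z} = ⊤) (ha : a ^ p = 1) {i d : ℕ} (hd : 1 ≤ d) (hdp : d < p)
    (hbot : Γ[G] (i + 1 + d) = ⊥) (hexp : ∀ u ∈ Γ[G] (i + 1 + 1), u ^ p = 1)
    (hcent : 1 ≤ i → ∀ u ∈ Γ[G] i, ∀ g, Commute (u ^ p) g) :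
    ∀ u ∈ Γ[G] (i + 1), u ^ p = 1 := by
  have hmul := fun (x : G) {y : G} => mul_pow_prime_of_mem_lowerCentralSeries (y := y)
    hp hd hdp hbot hexp x
  -- The elements of `Γ (i + 1)` of order dividing `p` form a normal subgroup of `G`.
  let K : Subgroup G :=
    { carrier := {u | u ∈ Γ[G] (i + 1) ∧ u ^ p = 1}
      one_mem' := ⟨one_mem _, one_pow p⟩
      mul_mem' := fun {u v} hu hv =>
        ⟨mul_mem hu.1 hv.1, by rw [(hmul u hv.1).1, hu.2, hv.2, one_mul]⟩
      inv_mem' := fun {u} hu => ⟨inv_mem hu.1, by rw [inv_pow, hu.2, inv_one]⟩ }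
  have hK : K.Normal := ⟨fun u hu g =>
    ⟨(inferInstance : (Γ[G] (i + 1)).Normal).conj_mem u hu.1 g, by
      rw [conj_pow, hu.2, mul_one, mul_inv_cancel]⟩⟩
  suffices h : ∀ u ∈ Γ[G] i, ∀ g, ⁅u, g⁆ ∈ K by
    have hle : Γ[G] (i + 1) ≤ K := commutator_le.mpr fun u hu g _ => h u hu g
    exact fun u hu => (hle hu).2
  have hcomm : ∀ u ∈ Γ[G] i, ∀ g, ⁅u, g⁆ ∈ Γ[G] (i + 1) := fun u hu g =>
    commutator_mem_commutator hu (mem_top g)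
  -- `u * a * u⁻¹ = ⁅u, a⁆ * a`, and both `a` and its conjugate have order dividing `p`.
  have hua : ∀ u ∈ Γ[G] i, ⁅u, a⁆ ∈ K := by
    intro u hu
    refine ⟨hcomm u hu a, ?_⟩
    have h := (hmul a (hcomm u hu a)).2
    rw [show ⁅u, a⁆ * a = u * a * u⁻¹ by simp [commutatorElement_def], conj_pow, ha, mul_one,
      mul_one, mul_inv_cancel] at h
    exact h.symm
  intro u hu
  refine commutatorElement_mem_of_closure_eq_top hgen ?_
  rintro g (rfl | rfl)
  · exact hua u hu
  rcases Nat.eq_zero_or_pos i with rfl | hi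
  · -- Here `Γ i` is the whole group, and `u` can in turn be replaced by the generators.
    rw [← commutatorElement_inv, inv_mem_iff]
    refine commutatorElement_mem_of_closure_eq_top hgen ?_ u
    rintro v (rfl | rfl)
    · exact hua g (mem_top g)
    · rw [commutatorElement_self]
      exact one_mem K
  · -- `g * u⁻¹ * g⁻¹ = u⁻¹ * ⁅u, g⁆`, and `u ^ p` is central.
    refine ⟨hcomm u hu g, ?_⟩
    have h := (hmul u⁻¹ (hcomm u hu g)).1
    rw [show u⁻¹ * ⁅u, g⁆ = g * u⁻¹ * g⁻¹ by simp [commutatorElement_def, mul_assoc], conj_pow,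
      inv_pow, ((hcent hi u hu g).inv_left).symm.eq, mul_inv_cancel_right] at h
    exact (mul_eq_left.mp h.symm)

/-- In a group generated by an element of order dividing `p` and one further element, the `p`-th
powers of the elements of `Γ i`, where `i ≥ 1`, lie in `Γ (i + (p - 1))`. -/
theorem pow_mem_lowerCentralSeries {p : ℕ} (hp : p.Prime) {a z : G}
    (hgen : closure {a, z} = ⊤) (ha : a ^ p = 1) (n : ℕ) :
    ∀ i, n ≤ i + 1 + (p - 1) → ∀ u ∈ Γ[G] (i + 1), u ^ p ∈ Γ[G] n := by
  induction n with
  | zero => exact fun _ _ _ _ => mem_top _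
  | succ n ih =>
    intro i hi
    -- Downward induction on `i`, starting from the trivial case `i ≥ n`.
    induction h : n - i generalizing i with
    | zero => exact fun u hu =>
        pow_mem (Subgroup.lowerCentralSeries_antitone _ (by omega) hu) p
    | succ k ihk =>
      intro u hu
      let q := QuotientGroup.mk' (Γ[G] (n + 1))
      have hq : Function.Surjective q := QuotientGroup.mk'_surjective _
      have hbot : Γ[G ⧸ Γ[G] (n + 1)] (n + 1) = ⊥ := lowerCentralSeries_quotient_eq_bot _ le_rfl
      have hgen' : closure {q a, q z} = ⊤ := by
        rw [← Set.image_pair, ← MonoidHom.map_closure, hgen, map_top_of_surjective q hq]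
      have key := pow_eq_one_of_mem_lowerCentralSeries hp hgen'
        (by rw [← map_pow, ha, map_one]) (i := i) (d := n - i) (by omega) (by have := hp.pos; omega)
        (by rwa [show i + 1 + (n - i) = n + 1 by omega]) ?_ ?_ (q u)
        (map_mem_lowerCentralSeries q hu)
      · rw [← map_pow] at key
        exact (QuotientGroup.eq_one_iff _).mp key
      · intro v hv
        obtain ⟨w, hw, rfl⟩ := exists_mem_lowerCentralSeries_of_surjective hq hv
        rw [← map_pow]
        exact (QuotientGroup.eq_one_iff _).mpr (ihk (i + 1) (by omega) (by omega) w hw)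
      · intro hi1 v hv
        obtain ⟨j, rfl⟩ := Nat.exists_eq_add_of_le' hi1
        obtain ⟨w, hw, rfl⟩ := exists_mem_lowerCentralSeries_of_surjective hq hv
        rw [← map_pow]
        exact commute_of_mem_lowerCentralSeries hbot
          (map_mem_lowerCentralSeries q (ih j (by omega) w hw))

/-- Raising `w = z ^ p ^ k` to the `p`-th power moves `⁅a, w⁆` down by `p - 1` terms: modulo the lower
term, `(⁅a, w⁆ * w) ^ p = w ^ p`, so that `w ^ p` is conjugate to itself by `a`. -/
theorem commutatorElement_pow_prime_pow_mem {p : ℕ} (hp : p.Prime) {a z : G}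
    (hgen : closure {a, z} = ⊤) (ha : a ^ p = 1) (k : ℕ) :
    ⁅a, z ^ p ^ k⁆ ∈ Γ[G] (k * (p - 1) + 1) := by
  induction k with
  | zero =>
    rw [zero_mul, zero_add]
    exact commutator_mem_commutator (mem_top _) (mem_top _)
  | succ k ih =>
    have hp2 := hp.two_le
    set w := z ^ p ^ k
    set n := k * (p - 1) + 1
    rw [show (k + 1) * (p - 1) + 1 = n + (p - 1) by simp only [n]; ring]
    let q := QuotientGroup.mk' (Γ[G] (n + (p - 1)))
    have hbot : Γ[G ⧸ Γ[G] (n + (p - 1))] (n + (p - 1)) = ⊥ :=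
      lowerCentralSeries_quotient_eq_bot _ le_rfl
    have hpow : ∀ j, n + (p - 1) ≤ j + 1 + (p - 1) → ∀ u ∈ Γ[G] (j + 1), q u ^ p = 1 := by
      intro j hj u hu
      rw [← map_pow]
      exact (QuotientGroup.eq_one_iff _).mpr (pow_mem_lowerCentralSeries hp hgen ha _ j hj u hu)
    have h := (mul_pow_prime_of_mem_lowerCentralSeries hp (n := p - 1) (i := n) (by omega)
      (by omega) hbot (by
        intro v hv
        obtain ⟨u, hu, rfl⟩ := exists_mem_lowerCentralSeries_of_surjective
          (QuotientGroup.mk'_surjective _) hv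
        exact hpow n (by omega) u hu) (q w) (map_mem_lowerCentralSeries q ih)).2
    rw [hpow _ le_rfl _ ih, one_mul, map_commutatorElement,
      show ⁅q a, q w⁆ * q w = q a * q w * (q a)⁻¹ by simp [commutatorElement_def], conj_pow,
      mul_inv_eq_iff_eq_mul, ← commutatorElement_eq_one_iff_mul_comm, ← map_pow,
      ← map_commutatorElement, ← pow_mul, ← pow_succ] at h
    exact (QuotientGroup.eq_one_iff _).mp h

end Exponents

/-! ### Semidirect products with a group of units -/

section SemidirectProduct

variable {A S : Type*} [Group A] [CommRing S]

/-- The action of `A` on the additive group of `S` by multiplication through `u : A →* Sˣ`. -/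
def unitsMulAction (u : A →* Sˣ) : A →* MulAut (Multiplicative S) :=
  ((MulAutMultiplicative S).symm.toMonoidHom.comp (DistribMulAction.toAddAut Sˣ S)).comp u

theorem toAdd_unitsMulAction_apply (u : A →* Sˣ) (a : A) (s : Multiplicative S) :
    (unitsMulAction u a s).toAdd = (u a : S) * s.toAdd := rfl

theorem toAdd_left_commutatorElement (u : A →* Sˣ)
    (x y : Multiplicative S ⋊[unitsMulAction u] A) :
    ⁅x, y⁆.left.toAdd =
      ((u x.right : S) - 1) * y.left.toAdd - ((u y.right : S) - 1) * x.left.toAdd := by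
  have hx : ((u x.right : Sˣ) : S) * ((u x.right)⁻¹ : Sˣ) = 1 := Units.mul_inv _
  have hy : ((u y.right : Sˣ) : S) * ((u y.right)⁻¹ : Sˣ) = 1 := Units.mul_inv _
  simp only [commutatorElement_def, SemidirectProduct.mul_left, SemidirectProduct.inv_left,
    SemidirectProduct.mul_right, SemidirectProduct.inv_right, toAdd_mul, toAdd_inv,
    toAdd_unitsMulAction_apply]
  simp only [map_mul, map_inv, Units.val_mul]
  linear_combination (-(u y.right : S) * x.left.toAdd -
    (u y.right : S) * ((u y.right)⁻¹ : Sˣ) * y.left.toAdd) * hx - y.left.toAdd * hy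

/-- The translations by multiples of `s` in the semidirect product of `S` with `A`. -/
def translationSubgroup (u : A →* Sˣ) (s : S) :
    Subgroup (Multiplicative S ⋊[unitsMulAction u] A) where
  carrier := {x | x.right = 1 ∧ s ∣ x.left.toAdd}
  one_mem' := ⟨rfl, dvd_zero s⟩
  mul_mem' := fun {x y} hx hy => ⟨by simp [hx.1, hy.1], by
    rw [SemidirectProduct.mul_left, hx.1, map_one, toAdd_mul]
    exact dvd_add hx.2 hy.2⟩
  inv_mem' := fun {x} hx => ⟨by simp [hx.1], by
    rw [SemidirectProduct.inv_left, hx.1, inv_one, map_one]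
    exact (dvd_neg (α := S)).mpr hx.2⟩

/-- If `A` is abelian and acts on `S` through units congruent to `1` modulo `π`, then the
translations by multiples of `π ^ (k + 1)` bound the lower central series of the semidirect
product. -/
theorem lowerCentralSeries_semidirectProduct_le (hA : ∀ a b : A, Commute a b) (u : A →* Sˣ)
    {π : S} (hu : ∀ a, π ∣ (u a : S) - 1) (k : ℕ) :
    Γ[Multiplicative S ⋊[unitsMulAction u] A] (k + 1) ≤ translationSubgroup u (π ^ (k + 1)) := by
  have hright : ∀ x y : Multiplicative S ⋊[unitsMulAction u] A, ⁅x, y⁆.right = 1 := fun x y => by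
    change SemidirectProduct.rightHom ⁅x, y⁆ = 1
    rw [map_commutatorElement, (hA _ _).commutator_eq]
  induction k with
  | zero =>
    refine commutator_le.mpr fun x _ y _ => ⟨hright x y, ?_⟩
    rw [toAdd_left_commutatorElement, zero_add, pow_one]
    exact dvd_sub (Dvd.dvd.mul_right (hu _) _) (Dvd.dvd.mul_right (hu _) _)
  | succ k ih =>
    refine commutator_le.mpr fun x hx y _ => ⟨hright x y, ?_⟩
    rw [toAdd_left_commutatorElement, (ih hx).1, map_one, Units.val_one, sub_self, zero_mul,
      zero_sub, dvd_neg, pow_succ']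
    exact mul_dvd_mul (hu _) (ih hx).2

end SemidirectProduct

/-! ### Divisibility by powers of `ζ - 1` -/

section Cyclotomic

open NumberField IsCyclotomicExtension.Rat

/-- As `(ζ - 1) ^ (p - 1)` is associated to `p`, each factor `p` of `m` accounts for `p - 1` factors
`ζ - 1`, and one remaining factor `ζ - 1` forces another factor `p`. -/
theorem prime_pow_dvd_of_zeta_sub_one_pow_dvd {p : ℕ} [Fact p.Prime] {K : Type*} [Field K]
    [NumberField K] [IsCyclotomicExtension {p} ℚ K] {ζ : K} (hζ : IsPrimitiveRoot ζ p) (k : ℕ)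
    (m : ℤ) (h : (hζ.toInteger - 1) ^ (k * (p - 1) + 1) ∣ (m : 𝓞 K)) : (p : ℤ) ^ (k + 1) ∣ m := by
  induction k generalizing m with
  | zero => simpa [zeta_sub_one_dvd_intCast_iff' p hζ] using h
  | succ k ih =>
    obtain ⟨m, rfl⟩ : (p : ℤ) ∣ m :=
      (zeta_sub_one_dvd_intCast_iff' p hζ).mp ((dvd_pow_self _ (by omega)).trans h)
    rw [pow_succ']
    refine mul_dvd_mul_left _ (ih m ?_)
    have hπ : (hζ.toInteger - 1) ^ (p - 1) ≠ 0 := pow_ne_zero _ hζ.zeta_sub_one_prime'.ne_zero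
    rw [Int.cast_mul, Int.cast_natCast, ((associated_zeta_sub_one_pow_prime p hζ).mul_right
      (m : 𝓞 K)).dvd_iff_dvd_right.symm, add_mul, one_mul, add_right_comm, add_comm, pow_add] at h
    exact (mul_dvd_mul_iff_left hπ).mp h

end Cyclotomic

/-! ### The nilpotent product -/

section NilpotentProduct

variable {A Z : Type*} [Group A] [Group Z]

theorem NilpotentProduct.lowerCentralSeries_eq_bot (c : ℕ) :
    Γ[NilpotentProduct c A Z] c = ⊥ :=
  lowerCentralSeries_quotient_eq_bot _ le_rfl

/-- Homomorphisms from the factors to a group of class at most `c` extend to the product. -/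
theorem NilpotentProduct.exists_lift {H : Type*} [Group H] {c : ℕ} (hH : Γ[H] c = ⊥)
    (f : A →* H) (g : Z →* H) : ∃ F : NilpotentProduct c A Z →* H,
      (∀ a, F (inl c A Z a) = f a) ∧ ∀ z, F (inr c A Z z) = g z := by
  refine ⟨QuotientGroup.lift _ (Monoid.Coprod.lift f g) fun w hw => ?_, fun a => ?_, fun z => ?_⟩
  · have := map_mem_lowerCentralSeries (Monoid.Coprod.lift f g) hw
    rwa [hH, mem_bot] at this
  · exact (QuotientGroup.lift_mk' _ _ _).trans (Monoid.Coprod.lift_apply_inl f g a)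
  · exact (QuotientGroup.lift_mk' _ _ _).trans (Monoid.Coprod.lift_apply_inr f g z)

theorem NilpotentProduct.closure_pair_eq_top (c : ℕ) {a : A} (ha : zpowers a = ⊤) {z : Z}
    (hz : zpowers z = ⊤) : closure {inl c A Z a, inr c A Z z} = ⊤ := by
  have h := Monoid.Coprod.range_inl_sup_range_inr (G := A) (H := Z)
  rw [MonoidHom.range_eq_map, MonoidHom.range_eq_map, ← ha, ← hz, MonoidHom.map_zpowers,
    MonoidHom.map_zpowers, zpowers_eq_closure, zpowers_eq_closure, ← Subgroup.closure_union,
    Set.singleton_union] at h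
  have h2 := congrArg (map (QuotientGroup.mk' (Γ[Monoid.Coprod A Z] c))) h
  rw [map_top_of_surjective _ (QuotientGroup.mk'_surjective _), MonoidHom.map_closure,
    Set.image_pair] at h2
  exact h2

/-- Let `ζ ≠ 1` be a `p`-th root of unity in a domain `R`. If `inr z ^ m` commutes with `inl a`,
then the same holds in the semidirect product of `R ⧸ (ζ - 1) ^ (c + 1)` with `A`, where `a` acts
as multiplication by `ζ` and `z` is sent to the translation by `1`. -/
theorem NilpotentProduct.sub_one_pow_dvd_of_commute [Infinite Z] {p : ℕ} (hp : p.Prime) {c : ℕ}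
    {a : A} (ha : zpowers a = ⊤) (hA : Nat.card A = p) {z : Z} (hz : zpowers z = ⊤)
    {m : ℤ} (hm : Commute (inl (c + 1) A Z a) (inr (c + 1) A Z z ^ m))
    {R : Type*} [CommRing R] [IsDomain R] {ζ : R} (hζp : ζ ^ p = 1) (hζ : ζ ≠ 1) :
    (ζ - 1) ^ c ∣ (m : R) := by
  have hga : ∀ x, x ∈ zpowers a := fun x => ha ▸ mem_top x
  have hgz : ∀ x, x ∈ zpowers z := fun x => hz ▸ mem_top x
  have hoa : orderOf a = p := by rw [orderOf_eq_card_of_forall_mem_zpowers hga, hA]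
  have hfin : Finite A := Nat.finite_of_card_ne_zero (hA ▸ hp.ne_zero)
  have hcomm : ∀ x y : A, Commute x y := fun x y => by
    obtain ⟨i, rfl⟩ := hga x
    obtain ⟨j, rfl⟩ := hga y
    exact (Commute.refl a).zpow_zpow i j
  let I : Ideal R := Ideal.span {(ζ - 1) ^ (c + 1)}
  let q := Ideal.Quotient.mk I
  let ε : (R ⧸ I)ˣ := Units.ofPowEqOne (q ζ) p (by rw [← map_pow, hζp, map_one]) hp.ne_zero
  have hε : orderOf ε ∣ orderOf a := hoa ▸ orderOf_dvd_of_pow_eq_one (Units.pow_ofPowEqOne _ _)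
  let u := monoidHomOfForallMemZpowers hga hε
  have hua : u a = ε := monoidHomOfForallMemZpowers_apply_gen hga hε
  have hdvd : ∀ x, q (ζ - 1) ∣ (u x : R ⧸ I) - 1 := fun x => by
    obtain ⟨j, rfl⟩ := mem_powers_iff_mem_zpowers.mpr (hga x)
    have h := sub_dvd_pow_sub_pow (q ζ) 1 j
    rw [one_pow] at h
    rwa [map_pow, hua, Units.val_pow_eq_pow_val, map_sub, map_one]
  have hbot : Γ[Multiplicative (R ⧸ I) ⋊[unitsMulAction u] A] (c + 1) = ⊥ := by
    rw [eq_bot_iff]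
    intro x hx
    obtain ⟨h1, h2⟩ := lowerCentralSeries_semidirectProduct_le hcomm u hdvd c hx
    have hI : (q (ζ - 1)) ^ (c + 1) = 0 := by
      rw [← map_pow]
      exact Ideal.Quotient.eq_zero_iff_mem.mpr (Ideal.mem_span_singleton_self _)
    rw [hI, zero_dvd_iff] at h2
    exact SemidirectProduct.ext h2 h1
  obtain ⟨F, hFa, hFz⟩ := NilpotentProduct.exists_lift hbot SemidirectProduct.inr
    (monoidHomOfForallMemZpowers (G' := Multiplicative (R ⧸ I) ⋊[unitsMulAction u] A)
      (g' := SemidirectProduct.inl (Multiplicative.ofAdd 1)) hgz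
      (by rw [Infinite.orderOf_eq_zero_of_forall_mem_zpowers hgz]; exact dvd_zero _))
  have h := congrArg (fun x => x.left.toAdd) (hm.map F).eq
  rw [map_zpow, hFa, hFz, monoidHomOfForallMemZpowers_apply_gen, ← map_zpow,
    ← ofAdd_zsmul, zsmul_one] at h
  simp only [SemidirectProduct.mul_left, SemidirectProduct.left_inr, SemidirectProduct.right_inr,
    SemidirectProduct.left_inl, SemidirectProduct.right_inl, one_mul, map_one, mul_one,
    toAdd_unitsMulAction_apply, toAdd_ofAdd, hua] at h
  have h2 : q ((ζ - 1) * (m : R)) = 0 := by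
    rw [map_mul, map_sub, map_one, map_intCast, sub_mul, one_mul, sub_eq_zero]
    exact h
  rwa [Ideal.Quotient.eq_zero_iff_mem, Ideal.mem_span_singleton, pow_succ',
    mul_dvd_mul_iff_left (sub_ne_zero.mpr hζ)] at h2

theorem NilpotentProduct.prime_pow_dvd_of_commute [Infinite Z] {p : ℕ} (hp : p.Prime) {c : ℕ}
    (hc : 1 ≤ c) {a : A} (ha : zpowers a = ⊤) (hA : Nat.card A = p) {z : Z} (hz : zpowers z = ⊤)
    {m : ℤ} (hm : Commute (inl (c + 1) A Z a) (inr (c + 1) A Z z ^ m)) :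
    (p : ℤ) ^ (1 + (c - 1) / (p - 1)) ∣ m := by
  have := Fact.mk hp
  have : NeZero p := ⟨hp.ne_zero⟩
  have : IsCyclotomicExtension {p} ℚ (CyclotomicField p ℚ) :=
    CyclotomicField.isCyclotomicExtension p ℚ
  have : NumberField (CyclotomicField p ℚ) := IsCyclotomicExtension.numberField {p} ℚ _
  have hζ := IsCyclotomicExtension.zeta_spec p ℚ (CyclotomicField p ℚ)
  have h := NilpotentProduct.sub_one_pow_dvd_of_commute hp ha hA hz hm
    hζ.toInteger_isPrimitiveRoot.pow_eq_one (hζ.toInteger_isPrimitiveRoot.ne_one hp.one_lt)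
  rw [add_comm]
  refine prime_pow_dvd_of_zeta_sub_one_pow_dvd hζ _ m ((pow_dvd_pow _ ?_).trans h)
  have := Nat.div_mul_le_self (c - 1) (p - 1)
  omega

theorem NilpotentProduct.inr_pow_mem_center {p : ℕ} (hp : p.Prime) {c : ℕ}
    {a : A} (ha : zpowers a = ⊤) (hA : Nat.card A = p) {z : Z} (hz : zpowers z = ⊤) :
    inr (c + 1) A Z z ^ p ^ (1 + (c - 1) / (p - 1)) ∈ center (NilpotentProduct (c + 1) A Z) := by
  have hgen := NilpotentProduct.closure_pair_eq_top (c + 1) ha hz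
  have hap : inl (c + 1) A Z a ^ p = 1 := by
    rw [← map_pow, ← hA, pow_card_eq_one', map_one]
  have hle : c + 1 ≤ (1 + (c - 1) / (p - 1)) * (p - 1) + 1 := by
    have h1 := Nat.lt_div_mul_add (a := c - 1) (b := p - 1) (by have := hp.two_le; omega)
    rw [add_mul, one_mul]
    omega
  have h := Subgroup.lowerCentralSeries_antitone _ hle
    (commutatorElement_pow_prime_pow_mem hp hgen hap (1 + (c - 1) / (p - 1)))
  rw [NilpotentProduct.lowerCentralSeries_eq_bot, mem_bot,
    commutatorElement_eq_one_iff_mul_comm] at h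
  rw [← centralizer_univ, ← coe_top, ← hgen, centralizer_closure, mem_centralizer_iff]
  rintro g (rfl | rfl)
  · exact h
  · exact (Commute.self_pow _ _).eq

end NilpotentProduct

theorem mainTheorem2 {A Z : Type*} [Group A] [Group Z] [Infinite Z]
    (p : ℕ) (hp : p.Prime) (c : ℕ) (hc : 1 ≤ c)
    (a : A) (ha : Subgroup.zpowers a = ⊤) (hA : Nat.card A = p)
    (z : Z) (hz : Subgroup.zpowers z = ⊤) :
    Subgroup.center (NilpotentProduct (c + 1) A Z) ⊓
        Subgroup.zpowers (NilpotentProduct.inr (c + 1) A Z z) =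
      Subgroup.zpowers
        (NilpotentProduct.inr (c + 1) A Z z ^ p ^ (1 + (c - 1) / (p - 1))) := by
  refine le_antisymm ?_ ?_
  · rintro _ ⟨hx, m, rfl⟩
    obtain ⟨n, rfl⟩ := NilpotentProduct.prime_pow_dvd_of_commute hp hc ha hA hz
      (mem_center_iff.mp hx _)
    exact ⟨n, by push_cast [← zpow_natCast, ← zpow_mul]; rfl⟩
  · rw [zpowers_le]
    exact ⟨NilpotentProduct.inr_pow_mem_center hp ha hA hz, pow_mem (mem_zpowers _) _⟩
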